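/- Let $\bar M$ be a saturated first-order structure in a language $L$, with $|\bar M|>|L|+\aleph_0$; "small" means of cardinality less than $|\bar M|$. A set of $n$-tuples is type-definable over $A\subseteq \bar M$ if it is an intersection of $A$-definable sets. Let $G\subseteq \bar M^n$ be a definable group or, more generally, a type-definable group, i.e. the set $G$ and the graph of its multiplication are type-definable over a small set of parameters. By a definable subset of $G$ we mean the intersection of $G$ with a subset of $\bar M^n$ that is definable with parameters; such a set is called $A$-definable if the parameters can be taken in $A$. Suppose that $G$ is compactly dominated: there are a compact Hausdorff group $H$ with normalized Haar measure $\mathbf m$ and a surjective group homomorphism $\pi:G\to H$ such that (a) there is a small set $A$ such that $\pi^{-1}(D)$ is type-definable over $A$ for every closed $D\subseteq H$, and (b) for every definable $Y\subseteq G$, $\mathbf m(\{h\in H:\pi^{-1}(h)\cap Y\neq\emptyset\text{ and }\pi^{-1}(h)\cap(G\setminus Y)\neq\emptyset\})=0$. A (global) Keisler measure on $G$ is a finitely additive probability measure on the Boolean algebra of definable subsets of $G$. Then $G$ has exactly one left-invariant Keisler measure $\mu$. Moreover, $\mu$ is right-invariant, and $\mu$ is smooth: there is a small elementary substructure $M_0\prec\bar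 M$, over which $G$ is type-definable, such that $\mu$ is the only Keisler measure on $G$ that agrees with $\mu$ on all $M_0$-definable subsets of $G$. -/

import Mathlib

universe u v w z

namespace CompactDomination

section Model

variable (L : FirstOrder.Language.{u, v}) (M : Type w) [L.Structure M]

/-- `M` is saturated: for every parameter set `A` with `|A| < |M|`, every finitely satisfiable
family of formulas over `A` in one variable (given by the `A`-definable subsets of `M` that they
define) is realized in `M`. -/
def IsSaturated : Prop :=
  ∀ A : Set M, Cardinal.mk A < Cardinal.mk M →
    ∀ F : Set (Set M), (∀ Y ∈ F, A.Definable₁ L Y) →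
      (∀ F₀ : Finset (Set M), (F₀ : Set (Set M)) ⊆ F → (⋂₀ (F₀ : Set (Set M))).Nonempty) →
      (⋂₀ F).Nonempty

/-- A large saturated model: a saturated structure whose cardinality exceeds `|L| + ℵ₀`. -/
structure IsLargeSaturated : Prop where
  aleph0_lt : Cardinal.aleph0 < Cardinal.mk M
  card_language_lt : Cardinal.lift.{w} L.card < Cardinal.lift.{max u v} (Cardinal.mk M)
  saturated : IsSaturated L M

variable {M}

/-- A set of parameters (or of anything else inside `M`) is small if it has fewer than `|M|`
elements. -/
def IsSmall (A : Set M) : Prop :=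
  Cardinal.mk A < Cardinal.mk M

/-- `X` is type-definable over `A`: an intersection of `A`-definable sets. In a large saturated
model, for small `A`, there are only a small number of `A`-definable sets, so this is the
intersection of a small collection. -/
def TypeDefinableOver (A : Set M) {α : Type*} (X : Set (α → M)) : Prop :=
  ∃ F : Set (Set (α → M)), (∀ Y ∈ F, A.Definable L Y) ∧ X = ⋂₀ F

/-- `Y` is a relatively definable subset of `X`, with parameters from `A`. -/
def RelDefinable {n : ℕ} {X : Set (Fin n → M)} (A : Set M) (Y : Set X) : Prop :=
  ∃ D : Set (Fin n → M), A.Definable L D ∧ Y = Subtype.val ⁻¹' D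

variable {L}

theorem RelDefinable.empty {n : ℕ} {X : Set (Fin n → M)} (A : Set M) :
    RelDefinable L A (∅ : Set X) :=
  ⟨∅, Set.definable_empty, by simp⟩

theorem RelDefinable.univ {n : ℕ} {X : Set (Fin n → M)} (A : Set M) :
    RelDefinable L A (Set.univ : Set X) :=
  ⟨Set.univ, Set.definable_univ, by simp⟩

theorem RelDefinable.union {n : ℕ} {X : Set (Fin n → M)} {A : Set M} {Y Z : Set X}
    (hY : RelDefinable L A Y) (hZ : RelDefinable L A Z) : RelDefinable L A (Y ∪ Z) := by
  obtain ⟨D, hD, rfl⟩ := hY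
  obtain ⟨E, hE, rfl⟩ := hZ
  exact ⟨D ∪ E, hD.union hE, rfl⟩

theorem RelDefinable.inter {n : ℕ} {X : Set (Fin n → M)} {A : Set M} {Y Z : Set X}
    (hY : RelDefinable L A Y) (hZ : RelDefinable L A Z) : RelDefinable L A (Y ∩ Z) := by
  obtain ⟨D, hD, rfl⟩ := hY
  obtain ⟨E, hE, rfl⟩ := hZ
  exact ⟨D ∩ E, hD.inter hE, rfl⟩

theorem RelDefinable.mono {n : ℕ} {X : Set (Fin n → M)} {A B : Set M} {Y : Set X}
    (hY : RelDefinable L A Y) (h : A ⊆ B) : RelDefinable L B Y := by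
  obtain ⟨D, hD, rfl⟩ := hY
  exact ⟨D, hD.mono h, rfl⟩

end Model

section Groups

variable (L : FirstOrder.Language.{u, v}) {M : Type w} [L.Structure M]

/-- The graph of the multiplication of a group whose underlying set is a set of `n`-tuples. -/
def mulGraph {n : ℕ} (G : Set (Fin n → M)) [Group G] : Set (Fin n ⊕ Fin n ⊕ Fin n → M) :=
  {t | ∃ x y : G, t = Sum.elim x.val (Sum.elim y.val (x * y).val)}

/-- `G` is a type-definable group: its underlying set and the graph of its multiplication are
type-definable over a small set of parameters. Every definable group is one. -/
def IsTypeDefinableGroup {n : ℕ} (G : Set (Fin n → M)) [Group G] : Prop :=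
  ∃ A : Set M, IsSmall A ∧ TypeDefinableOver L A G ∧ TypeDefinableOver L A (mulGraph G)

end Groups

section Keisler

variable (L : FirstOrder.Language.{u, v}) {M : Type w} [L.Structure M] {n : ℕ}

/-- A Keisler measure on `X` over `A`: a finitely additive probability measure on the Boolean
algebra of subsets of `X` that are (relatively) definable over `A`. -/
structure KeislerMeasure (X : Set (Fin n → M)) (A : Set M) where
  toFun : {Y : Set X // RelDefinable L A Y} → ℝ
  mem_Icc : ∀ Y, toFun Y ∈ Set.Icc (0 : ℝ) 1
  empty : toFun ⟨∅, RelDefinable.empty A⟩ = 0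
  univ : toFun ⟨Set.univ, RelDefinable.univ A⟩ = 1
  union : ∀ Y Z : {Y : Set X // RelDefinable L A Y},
    toFun ⟨Y.1 ∪ Z.1, Y.2.union Z.2⟩ =
      toFun Y + toFun Z - toFun ⟨Y.1 ∩ Z.1, Y.2.inter Z.2⟩

/-- A global Keisler measure on `X`: a measure of all subsets of `X` definable with parameters
in `M`. -/
abbrev GlobalKeislerMeasure (X : Set (Fin n → M)) :=
  KeislerMeasure L X (Set.univ : Set M)

variable {L}

/-- The restriction `μ|A` of a Keisler measure over `B` to a smaller set of parameters `A`. -/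
def KeislerMeasure.restrict {X : Set (Fin n → M)} {B : Set M} (μ : KeislerMeasure L X B)
    {A : Set M} (h : A ⊆ B) : KeislerMeasure L X A where
  toFun Y := μ.toFun ⟨Y.1, Y.2.mono h⟩
  mem_Icc _ := μ.mem_Icc _
  empty := μ.empty
  univ := μ.univ
  union Y Z := μ.union ⟨Y.1, Y.2.mono h⟩ ⟨Z.1, Z.2.mono h⟩

/-- `μ` is smooth over `A`: it is the only global Keisler measure on `X` that extends `μ|A`. -/
def KeislerMeasure.IsSmoothOver {X : Set (Fin n → M)} (μ : GlobalKeislerMeasure L X)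
    (A : Set M) : Prop :=
  ∀ ν : GlobalKeislerMeasure L X,
    ν.restrict (Set.subset_univ A) = μ.restrict (Set.subset_univ A) → ν = μ

/-- `μ` is smooth: it is smooth over some small elementary substructure over which `X` is
type-definable. -/
def KeislerMeasure.IsSmooth {X : Set (Fin n → M)} (μ : GlobalKeislerMeasure L X) : Prop :=
  ∃ M₀ : L.ElementarySubstructure M, IsSmall (M₀ : Set M) ∧
    TypeDefinableOver L (M₀ : Set M) X ∧ μ.IsSmoothOver (M₀ : Set M)

/-- `μ (gY) = μ Y` for all `g` in `G` and all definable subsets `Y` of `G`. -/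
def KeislerMeasure.IsLeftInvariant {G : Set (Fin n → M)} [Group G]
    (μ : GlobalKeislerMeasure L G) : Prop :=
  ∀ (g : G) (Y Z : {Y : Set G // RelDefinable L (Set.univ : Set M) Y}),
    Z.1 = (fun x => g * x) '' Y.1 → μ.toFun Z = μ.toFun Y

/-- `μ (Yg) = μ Y` for all `g` in `G` and all definable subsets `Y` of `G`. -/
def KeislerMeasure.IsRightInvariant {G : Set (Fin n → M)} [Group G]
    (μ : GlobalKeislerMeasure L G) : Prop :=
  ∀ (g : G) (Y Z : {Y : Set G // RelDefinable L (Set.univ : Set M) Y}),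
    Z.1 = (fun x => x * g) '' Y.1 → μ.toFun Z = μ.toFun Y

end Keisler

section Domination

variable (L : FirstOrder.Language.{u, v}) {M : Type w} [L.Structure M] {n : ℕ}

/-- A map `f : X → C` to a compact space is definable if, for some small `A`, the preimage of every
closed set is type-definable over `A`. (For the closed set `C` this says that `X` itself is
type-definable over `A`.) -/
def IsDefinableMap {X : Set (Fin n → M)} {C : Type z} [TopologicalSpace C] (f : X → C) : Prop :=
  ∃ A : Set M, IsSmall A ∧
    ∀ D : Set C, IsClosed D → TypeDefinableOver L A (Subtype.val '' (f ⁻¹' D))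

/-- `X` is compactly dominated by `(C, μ, f)`. -/
structure IsCompactlyDominated (X : Set (Fin n → M)) {C : Type z} [TopologicalSpace C]
    [CompactSpace C] [T2Space C] [MeasurableSpace C] [BorelSpace C]
    (μ : MeasureTheory.Measure C) [MeasureTheory.IsProbabilityMeasure μ] (f : X → C) : Prop where
  surjective : Function.Surjective f
  definable : IsDefinableMap L f
  null : ∀ Y : Set X, RelDefinable L (Set.univ : Set M) Y →
    μ {c | (f ⁻¹' {c} ∩ Y).Nonempty ∧ (f ⁻¹' {c} ∩ Yᶜ).Nonempty} = 0

/-- The normalized Haar measure of a compact Hausdorff group. -/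
noncomputable def normalizedHaar (H : Type z) [Group H] [TopologicalSpace H]
    [IsTopologicalGroup H] [CompactSpace H] [MeasurableSpace H] [BorelSpace H] :
    MeasureTheory.Measure H :=
  MeasureTheory.Measure.haarMeasure (⊤ : TopologicalSpace.PositiveCompacts H)

instance (H : Type z) [Group H] [TopologicalSpace H] [IsTopologicalGroup H] [CompactSpace H]
    [MeasurableSpace H] [BorelSpace H] :
    MeasureTheory.IsProbabilityMeasure (normalizedHaar H) :=
  ⟨MeasureTheory.Measure.haarMeasure_self (K₀ := (⊤ : TopologicalSpace.PositiveCompacts H))⟩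

/-- The group `G` is compactly dominated, as a group, by the compact group `H` with its normalized
Haar measure, via the homomorphism `π`. -/
def IsCompactlyDominatedGroup (G : Set (Fin n → M)) [Group G] {H : Type z} [Group H]
    [TopologicalSpace H] [IsTopologicalGroup H] [CompactSpace H] [T2Space H] [MeasurableSpace H]
    [BorelSpace H] (π : G →* H) : Prop :=
  IsCompactlyDominated L G (normalizedHaar H) π

end Domination

end CompactDomination

open CompactDomination

/-!
In a saturated model a definable map to a compact space sends definable sets to closed sets, so
`μ Y = m (π Y)` makes sense; the sets `π Y` and `π (Yᶜ)` overlap in a null set, which makes `μ`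
finitely additive. Invariance of `μ` is invariance of Haar measure.

An arbitrary Keisler measure `ν` only has to be bounded from above: if `ν Y ≤ m U` for all open
`U ⊇ π Y`, then `ν ≤ μ` by outer regularity, and `ν = μ` by passing to complements.
* If `ν` agrees with `μ` over `M₀`, saturation gives an `M₀`-definable `Z` between `Y` and `π⁻¹ U`,
  and `ν Y ≤ ν Z = m (π Z) ≤ m U`.
* If `ν` is left-invariant, round a Haar-random `b` to a simple function `φ b` with `b (φ b)⁻¹` so
  close to `1` that `φ b * h ∈ π Y` implies `b * h ∈ U`. For each `h` the first event then has
  probability at most `m U`, that is, a finite convex combination of the indicator functions of left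
  translates of `Y` is bounded by `m U`. Integrating against `ν` gives `ν Y ≤ m U`.
-/

namespace CompactDomination

open MeasureTheory Filter Topology

section Saturation

variable {L : FirstOrder.Language.{u, v}} {M : Type w} [L.Structure M] {A B : Set M}
  {α β : Type*}

theorem IsSmall.union [Infinite M] (hA : IsSmall A) (hB : IsSmall B) : IsSmall (A ∪ B) :=
  (Cardinal.mk_union_le A B).trans_lt (Cardinal.add_lt_of_lt (Cardinal.aleph0_le_mk M) hA hB)

theorem IsSmall.of_finite [Infinite M] (hA : A.Finite) : IsSmall A :=
  hA.lt_aleph0.trans_le (Cardinal.aleph0_le_mk M)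

theorem TypeDefinableOver.mono {X : Set (α → M)} (hX : TypeDefinableOver L A X) (h : A ⊆ B) :
    TypeDefinableOver L B X := by
  obtain ⟨F, hF, rfl⟩ := hX
  exact ⟨F, fun Y hY => (hF Y hY).mono h, rfl⟩

theorem TypeDefinableOver.inter {X Y : Set (α → M)} (hX : TypeDefinableOver L A X)
    (hY : TypeDefinableOver L A Y) : TypeDefinableOver L A (X ∩ Y) := by
  obtain ⟨F, hF, rfl⟩ := hX
  obtain ⟨E, hE, rfl⟩ := hY
  refine ⟨F ∪ E, ?_, (Set.sInter_union F E).symm⟩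
  rintro Z (hZ | hZ)
  exacts [hF Z hZ, hE Z hZ]

theorem TypeDefinableOver.of_definable {X : Set (α → M)} (hX : A.Definable L X) :
    TypeDefinableOver L A X :=
  ⟨{X}, by simpa using hX, Set.sInter_singleton X |>.symm⟩

theorem definable_sInter_of_finite {F : Set (Set (α → M))} (hF : F.Finite)
    (h : ∀ Y ∈ F, A.Definable L Y) : A.Definable L (⋂₀ F) := by
  have := hF.to_subtype
  rw [Set.sInter_eq_iInter]
  exact Set.definable_iInter_of_finite fun Y => h Y Y.2

theorem definable_setOf_apply_eq (i : α) {a : M} (ha : a ∈ A) :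
    A.Definable L {t : α → M | t i = a} :=
  Set.Definable.preimage_comp (fun _ : Fin 1 => i) (Set.Definable.singleton_of_mem L ha)

theorem definable_setOf_eqOn {s : Set α} (hs : s.Finite) {a : α → M} (ha : ∀ i ∈ s, a i ∈ A) :
    A.Definable L {t : α → M | Set.EqOn t a s} := by
  have := hs.to_subtype
  have : {t : α → M | Set.EqOn t a s} = ⋂ i : s, {t | t i = a i} := by
    ext t
    simp [Set.EqOn]
  rw [this]
  exact Set.definable_iInter_of_finite fun i => definable_setOf_apply_eq _ (ha i i.2)

theorem definable_setOf_comp_eq [Finite β] (f : β → α) {a : β → M} (ha : ∀ i, a i ∈ A) :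
    A.Definable L {t : α → M | t ∘ f = a} := by
  have : {t : α → M | t ∘ f = a} = ⋂ i, {t | t (f i) = a i} := by
    ext t
    simp [funext_iff]
  rw [this]
  exact Set.definable_iInter_of_finite fun i => definable_setOf_apply_eq _ (ha i)

theorem definable₁_image_eval [Finite α] {X : Set (α → M)} (hX : A.Definable L X) (i : α) :
    A.Definable₁ L (Function.eval i '' X) := by
  have : {x : Fin 1 → M | x 0 ∈ Function.eval i '' X} =
      (fun t : α → M => t ∘ fun _ : Fin 1 => i) '' X := by
    ext x
    simp [funext_iff]
  rw [Set.Definable₁, this]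
  exact hX.image_comp _

theorem IsSaturated.exists_forall_inter_setOf_apply_eq_nonempty [Infinite M]
    (hM : IsSaturated L M) [Finite α] (hA : IsSmall A) (hB : IsSmall B) {𝓗 : Filter (α → M)}
    {E : Set (α → M)} (hE : B.Definable L E)
    (h : ∀ D ∈ 𝓗, A.Definable L D → (D ∩ E).Nonempty) (i : α) :
    ∃ b, ∀ D ∈ 𝓗, A.Definable L D → (D ∩ (E ∩ {t | t i = b})).Nonempty := by
  let F : Set (Set M) := (fun D => Function.eval i '' (D ∩ E)) '' {D ∈ 𝓗.sets | A.Definable L D}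
  obtain ⟨b, hb⟩ : (⋂₀ F).Nonempty := by
    refine hM (A ∪ B) (hA.union hB) F ?_ fun F₀ hF₀ => ?_
    · rintro _ ⟨D, ⟨-, hD⟩, rfl⟩
      exact definable₁_image_eval
        ((hD.mono Set.subset_union_left).inter (hE.mono Set.subset_union_right)) i
    · choose! D hD hDZ using fun Z (hZ : Z ∈ F₀) => hF₀ hZ
      have hfin := F₀.finite_toSet.image D
      obtain ⟨t, htD, htE⟩ := h (⋂₀ (D '' F₀))
        ((sInter_mem hfin).2 (Set.forall_mem_image.2 fun Z hZ => (hD Z hZ).1))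
        (definable_sInter_of_finite hfin (Set.forall_mem_image.2 fun Z hZ => (hD Z hZ).2))
      exact ⟨t i, fun Z hZ => hDZ Z hZ ▸ ⟨t, ⟨htD _ ⟨Z, hZ, rfl⟩, htE⟩, rfl⟩⟩
  refine ⟨b, fun D hD hDA => ?_⟩
  obtain ⟨t, ⟨htD, htE⟩, htb⟩ := hb _ ⟨D, ⟨hD, hDA⟩, rfl⟩
  exact ⟨t, htD, htE, htb⟩

theorem IsSaturated.exists_forall_definable_mem [Infinite M] (hM : IsSaturated L M) [Finite α]
    (hA : IsSmall A) (𝓗 : Filter (α → M)) [𝓗.NeBot] :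
    ∃ t, ∀ D ∈ 𝓗, A.Definable L D → t ∈ D := by
  classical
  cases nonempty_fintype α
  have realize_on (s : Finset α) :
      ∃ a, ∀ D ∈ 𝓗, A.Definable L D → (D ∩ {t | Set.EqOn t a s}).Nonempty := by
    induction s using Finset.induction_on with
    | empty =>
      obtain ⟨a⟩ := 𝓗.nonempty_of_neBot
      exact ⟨a, fun D hD _ => by simpa using 𝓗.nonempty_of_mem hD⟩
    | insert i s hi ih =>
      obtain ⟨a, ha⟩ := ih
      obtain ⟨b, hb⟩ := hM.exists_forall_inter_setOf_apply_eq_nonempty hA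
        (IsSmall.of_finite (Set.finite_range a))
        (definable_setOf_eqOn s.finite_toSet fun j _ => Set.mem_range_self j) ha i
      refine ⟨Function.update a i b, fun D hD hDA => (hb D hD hDA).mono ?_⟩
      rintro t ⟨htD, hta, htb⟩
      refine ⟨htD, ?_⟩
      intro j hj
      rcases Finset.mem_insert.1 hj with rfl | hj
      · rw [Function.update_self, htb]
      · rw [Function.update_of_ne (ne_of_mem_of_not_mem hj hi), hta hj]
  obtain ⟨t, ht⟩ := realize_on Finset.univ
  refine ⟨t, fun D hD hDA => ?_⟩
  obtain ⟨t', ht', heq⟩ := ht D hD hDA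
  have : t' = t := by simpa using heq
  exact this ▸ ht'

theorem IsSaturated.exists_forall_typeDefinable_mem [Infinite M] (hM : IsSaturated L M)
    [Finite α] (hA : IsSmall A) (𝓗 : Filter (α → M)) [𝓗.NeBot] :
    ∃ t, ∀ X ∈ 𝓗, TypeDefinableOver L A X → t ∈ X := by
  obtain ⟨t, ht⟩ := hM.exists_forall_definable_mem hA 𝓗
  refine ⟨t, ?_⟩
  rintro _ hX ⟨F, hF, rfl⟩ Z hZ
  exact ht Z (mem_of_superset hX (Set.sInter_subset_of_mem hZ)) (hF Z hZ)

theorem IsSaturated.exists_definable_separation [Infinite M] (hM : IsSaturated L M) [Finite α]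
    (hA : IsSmall A) (hB : IsSmall B) {X Y : Set (α → M)} (hX : TypeDefinableOver L A X)
    (hY : TypeDefinableOver L B Y) (hXY : Disjoint X Y) :
    ∃ D, A.Definable L D ∧ X ⊆ D ∧ Disjoint D Y := by
  obtain ⟨F, hF, rfl⟩ := hX
  obtain ⟨E, hE, rfl⟩ := hY
  by_contra! hmeet
  have hne : (generate F ⊓ 𝓟 (⋂₀ E)).NeBot := by
    refine inf_principal_neBot_iff.2 fun U hU => ?_
    obtain ⟨F₀, hF₀, hfin, hU⟩ := mem_generate_iff.1 hU
    have hdef := definable_sInter_of_finite hfin fun Z hZ => hF Z (hF₀ hZ)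
    have := hmeet _ hdef (Set.sInter_subset_sInter hF₀)
    exact (Set.not_disjoint_iff_nonempty_inter.1 this).mono (Set.inter_subset_inter_left _ hU)
  obtain ⟨t, ht⟩ := hM.exists_forall_definable_mem (hA.union hB) (generate F ⊓ 𝓟 (⋂₀ E))
  have htF : t ∈ ⋂₀ F := fun Z hZ =>
    ht Z (mem_inf_of_left (.basic hZ)) ((hF Z hZ).mono Set.subset_union_left)
  have htE : t ∈ ⋂₀ E := fun Z hZ =>
    ht Z (mem_inf_of_right (mem_principal.2 (Set.sInter_subset_of_mem hZ)))
      ((hE Z hZ).mono Set.subset_union_right)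
  exact Set.disjoint_left.1 hXY htF htE

theorem IsSaturated.typeDefinableOver_image_comp [Infinite M] (hM : IsSaturated L M) [Finite α]
    [Finite β] (hA : IsSmall A) {X : Set (α → M)} (hX : TypeDefinableOver L A X) (f : β → α) :
    TypeDefinableOver L A ((fun t => t ∘ f) '' X) := by
  refine ⟨{Z | A.Definable L Z ∧ (fun t => t ∘ f) '' X ⊆ Z}, fun Z hZ => hZ.1,
    Set.Subset.antisymm (Set.subset_sInter fun Z hZ => hZ.2) fun z hz => ?_⟩
  by_contra hzX
  have hdisj : Disjoint X {t | t ∘ f = z} :=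
    Set.disjoint_left.2 fun t ht htz => hzX ⟨t, ht, htz⟩
  obtain ⟨D, hD, hXD, hDz⟩ := hM.exists_definable_separation hA
    (IsSmall.of_finite (Set.finite_range z)) hX
    (.of_definable (definable_setOf_comp_eq f Set.mem_range_self)) hdisj
  obtain ⟨t, ht, htz⟩ := hz _ ⟨hD.image_comp f, Set.image_mono hXD⟩
  exact Set.disjoint_left.1 hDz ht htz

theorem exists_small_elementarySubstructure (hM : Cardinal.aleph0 < Cardinal.mk M)
    (hL : Cardinal.lift.{w} L.card < Cardinal.lift.{max u v} (Cardinal.mk M)) (hA : IsSmall A) :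
    ∃ M₀ : L.ElementarySubstructure M, A ⊆ M₀ ∧ IsSmall (M₀ : Set M) := by
  obtain ⟨κ, hκ, hκL⟩ := Cardinal.lt_lift_iff.1 hL
  let c := max (Cardinal.mk A) (max Cardinal.aleph0 κ)
  have hcM : c < Cardinal.mk M := max_lt hA (max_lt hM hκ)
  have hκc : κ ≤ c := (le_max_right _ _).trans (le_max_right _ _)
  obtain ⟨M₀, hAM₀, hcard⟩ := FirstOrder.Language.exists_elementarySubstructure_card_eq L A c
    ((le_max_left _ _).trans (le_max_right _ _)) (Cardinal.lift_le.2 (le_max_left _ _))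
    (hκL ▸ Cardinal.lift_le.2 hκc) (Cardinal.lift_le.2 hcM.le)
  exact ⟨M₀, hAM₀, (Cardinal.lift_injective hcard).trans_lt hcM⟩

end Saturation

section RelDefinable

variable {L : FirstOrder.Language.{u, v}} {M : Type w} [L.Structure M] {A : Set M} {m n : ℕ}
  {X : Set (Fin m → M)} {Z : Set (Fin n → M)}

theorem RelDefinable.compl {Y : Set X} (hY : RelDefinable L A Y) : RelDefinable L A Yᶜ := by
  obtain ⟨D, hD, rfl⟩ := hY
  exact ⟨Dᶜ, hD.compl, rfl⟩

theorem RelDefinable.sdiff {Y₁ Y₂ : Set X} (h₁ : RelDefinable L A Y₁) (h₂ : RelDefinable L A Y₂) :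
    RelDefinable L A (Y₁ \ Y₂) :=
  h₁.inter h₂.compl

theorem RelDefinable.exists_finite {Y : Set X} (hY : RelDefinable L A Y) :
    ∃ B : Set M, B.Finite ∧ RelDefinable L B Y := by
  obtain ⟨D, hD, rfl⟩ := hY
  obtain ⟨B, -, hB⟩ := Set.definable_iff_finitely_definable.1 hD
  exact ⟨B, B.finite_toSet, D, hB, rfl⟩

theorem IsSaturated.relDefinable_of_typeDefinableOver [Infinite M] (hM : IsSaturated L M)
    (hA : IsSmall A) {Y : Set X} (hY : TypeDefinableOver L A (Subtype.val '' Y))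
    (hYc : TypeDefinableOver L A (Subtype.val '' Yᶜ)) : RelDefinable L A Y := by
  have hdisj : Disjoint (Subtype.val '' Y) (Subtype.val '' Yᶜ) :=
    (Set.disjoint_image_iff Subtype.val_injective).2 disjoint_compl_right
  obtain ⟨D, hD, hYD, hDYc⟩ := hM.exists_definable_separation hA hA hY hYc hdisj
  refine ⟨D, hD, Set.Subset.antisymm (Set.image_subset_iff.1 hYD) fun x hxD => ?_⟩
  by_contra hxY
  exact Set.disjoint_left.1 hDYc hxD ⟨x, hxY, rfl⟩

/-- The graph of a map between two sets of tuples, as a set of concatenated tuples. Maps with a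
type-definable graph are the morphisms along which definable sets pull back to definable sets. -/
def mapGraph (f : X → Z) : Set (Fin m ⊕ Fin n → M) :=
  {t | ∃ x, t = Sum.elim x.val (f x).val}

theorem image_val_preimage_preimage_val (f : X → Z) (D : Set (Fin n → M)) :
    (Subtype.val '' (f ⁻¹' (Subtype.val ⁻¹' D)) : Set (Fin m → M)) =
      (fun t : Fin m ⊕ Fin n → M => t ∘ Sum.inl) '' (mapGraph f ∩ {t | t ∘ Sum.inr ∈ D}) := by
  ext z
  constructor
  · rintro ⟨x, hx, rfl⟩
    exact ⟨_, ⟨⟨x, rfl⟩, hx⟩, rfl⟩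
  · rintro ⟨_, ⟨⟨x, rfl⟩, hx⟩, rfl⟩
    exact ⟨x, hx, rfl⟩

theorem IsSaturated.relDefinable_preimage [Infinite M] (hM : IsSaturated L M) (hA : IsSmall A)
    {f : X → Z} (hf : TypeDefinableOver L A (mapGraph f)) {Y : Set Z}
    (hY : RelDefinable L Set.univ Y) : RelDefinable L Set.univ (f ⁻¹' Y) := by
  obtain ⟨B, hB, hY⟩ := hY.exists_finite
  have hAB : IsSmall (A ∪ B) := hA.union (.of_finite hB)
  have typeDefinableOver_preimage {W : Set Z} (hW : RelDefinable L B W) :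
      TypeDefinableOver L (A ∪ B) (Subtype.val '' (f ⁻¹' W)) := by
    obtain ⟨D, hD, rfl⟩ := hW
    have hD' := (hD.mono (Set.subset_union_right (s := A))).preimage_comp
      (Sum.inr : Fin n → Fin m ⊕ Fin n)
    rw [image_val_preimage_preimage_val]
    exact hM.typeDefinableOver_image_comp hAB
      ((hf.mono Set.subset_union_left).inter (.of_definable hD')) _
  exact (hM.relDefinable_of_typeDefinableOver hAB (typeDefinableOver_preimage hY)
    (typeDefinableOver_preimage hY.compl)).mono (Set.subset_univ _)

variable {G : Set (Fin n → M)} [Group G]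

theorem mapGraph_mul_left (g : G) :
    mapGraph (fun x : G => g * x) =
      (fun t : Fin n ⊕ Fin n ⊕ Fin n → M => t ∘ Sum.inr) ''
        (mulGraph G ∩ {t | t ∘ Sum.inl = g.val}) := by
  ext t
  constructor
  · rintro ⟨x, rfl⟩
    exact ⟨_, ⟨⟨g, x, rfl⟩, rfl⟩, rfl⟩
  · rintro ⟨_, ⟨⟨x, y, rfl⟩, hx⟩, rfl⟩
    obtain rfl : x = g := Subtype.ext hx
    exact ⟨y, rfl⟩

theorem IsTypeDefinableGroup.relDefinable_preimage_mul_left [Infinite M] (hM : IsSaturated L M)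
    (hG : IsTypeDefinableGroup L G) (g : G) {Y : Set G} (hY : RelDefinable L Set.univ Y) :
    RelDefinable L Set.univ ((fun x => g * x) ⁻¹' Y) := by
  obtain ⟨A, hA, -, hmul⟩ := hG
  have hsmall : IsSmall (A ∪ Set.range g.val) := hA.union (.of_finite (Set.finite_range _))
  have hgraph : TypeDefinableOver L (A ∪ Set.range g.val) (mapGraph fun x : G => g * x) := by
    have hg := definable_setOf_comp_eq (L := L) (A := A ∪ Set.range g.val)
      (Sum.inl : Fin n → Fin n ⊕ Fin n ⊕ Fin n) fun i => Or.inr (Set.mem_range_self i)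
    rw [mapGraph_mul_left]
    exact hM.typeDefinableOver_image_comp hsmall
      ((hmul.mono Set.subset_union_left).inter (.of_definable hg)) _
  exact hM.relDefinable_preimage hsmall hgraph hY

end RelDefinable

section Keisler

variable {L : FirstOrder.Language.{u, v}} {M : Type w} [L.Structure M] {n : ℕ}
  {X : Set (Fin n → M)} {A : Set M} {Y Z : Set X}

namespace KeislerMeasure

open Classical in
/-- The value of a Keisler measure at an arbitrary set, with the junk value `0` at sets that are
not definable; it avoids carrying definability proofs inside terms. -/
noncomputable def eval (ν : KeislerMeasure L X A) (Y : Set X) : ℝ :=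
  if h : RelDefinable L A Y then ν.toFun ⟨Y, h⟩ else 0

variable (ν : KeislerMeasure L X A)

theorem eval_eq (hY : RelDefinable L A Y) : ν.eval Y = ν.toFun ⟨Y, hY⟩ :=
  dif_pos hY

theorem eval_nonneg (Y : Set X) : 0 ≤ ν.eval Y := by
  unfold eval
  split_ifs
  exacts [(ν.mem_Icc _).1, le_rfl]

theorem eval_empty : ν.eval ∅ = 0 :=
  (ν.eval_eq (RelDefinable.empty A)).trans ν.empty

theorem eval_univ : ν.eval Set.univ = 1 :=
  (ν.eval_eq (RelDefinable.univ A)).trans ν.univ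

theorem eval_inter_add_sdiff (hY : RelDefinable L A Y) (hZ : RelDefinable L A Z) :
    ν.eval (Y ∩ Z) + ν.eval (Y \ Z) = ν.eval Y := by
  have hunion := ν.union ⟨_, hY.inter hZ⟩ ⟨_, hY.sdiff hZ⟩
  simp only [← eval_eq, Set.inter_union_sdiff,
    Set.disjoint_sdiff_inter.symm.inter_eq, eval_empty, sub_zero] at hunion
  exact hunion.symm

theorem eval_mono (hY : RelDefinable L A Y) (hZ : RelDefinable L A Z) (h : Y ⊆ Z) :
    ν.eval Y ≤ ν.eval Z := by
  have := ν.eval_inter_add_sdiff hZ hY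
  rw [Set.inter_eq_right.2 h] at this
  linarith [ν.eval_nonneg (Z \ Y)]

theorem eval_compl (hY : RelDefinable L A Y) : ν.eval Yᶜ = 1 - ν.eval Y := by
  have := ν.eval_inter_add_sdiff (RelDefinable.univ A) hY
  rw [Set.univ_inter, ← Set.compl_eq_univ_sdiff, ν.eval_univ] at this
  linarith

variable {ν}

theorem eq_of_eval_le {μ : KeislerMeasure L X A}
    (h : ∀ Y, RelDefinable L A Y → ν.eval Y ≤ μ.eval Y) : ν = μ := by
  have heq : ν.toFun = μ.toFun := by
    funext ⟨Y, hY⟩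
    have hcompl := h Yᶜ hY.compl
    rw [ν.eval_compl hY, μ.eval_compl hY] at hcompl
    rw [← ν.eval_eq hY, ← μ.eval_eq hY]
    linarith [h Y hY]
  cases ν
  cases μ
  cases heq
  rfl

theorem sum_mul_eval_inter_le (ν : KeislerMeasure L X A) {ι : Type*} (s : Finset ι) (c : ι → ℝ)
    {Y : ι → Set X} (hY : ∀ i, RelDefinable L A (Y i)) (hZ : RelDefinable L A Z) {r : ℝ}
    (h : ∀ x ∈ Z, ∑ i ∈ s, (Y i).indicator (fun _ => c i) x ≤ r) :
    ∑ i ∈ s, c i * ν.eval (Z ∩ Y i) ≤ r * ν.eval Z := by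
  classical
  induction s using Finset.induction_on generalizing Z r with
  | empty =>
    rcases Z.eq_empty_or_nonempty with rfl | ⟨x, hx⟩
    · simp [ν.eval_empty]
    · simpa using mul_nonneg (by simpa using h x hx) (ν.eval_nonneg Z)
  | insert j s hj ih =>
    have hinside := ih (hZ.inter (hY j)) (r := r - c j) fun x hx => by
      have := h x hx.1
      rw [Finset.sum_insert hj, Set.indicator_of_mem hx.2] at this
      linarith
    have houtside := ih (hZ.sdiff (hY j)) (r := r) fun x hx => by
      have := h x hx.1
      rwa [Finset.sum_insert hj, Set.indicator_of_notMem hx.2, zero_add] at this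
    have hsplit (i : ι) : ν.eval (Z ∩ Y i) =
        ν.eval (Z ∩ Y j ∩ Y i) + ν.eval ((Z \ Y j) ∩ Y i) := by
      rw [Set.inter_right_comm, Set.sdiff_inter_right_comm,
        ν.eval_inter_add_sdiff (hZ.inter (hY i)) (hY j)]
    have hsum : ∑ i ∈ s, c i * ν.eval (Z ∩ Y i) =
        ∑ i ∈ s, c i * ν.eval (Z ∩ Y j ∩ Y i) + ∑ i ∈ s, c i * ν.eval ((Z \ Y j) ∩ Y i) := by
      simp only [hsplit, mul_add, Finset.sum_add_distrib]
    rw [Finset.sum_insert hj, hsum, ← ν.eval_inter_add_sdiff hZ (hY j)]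
    linarith

theorem sum_mul_eval_le (ν : KeislerMeasure L X A) {ι : Type*} (s : Finset ι) (c : ι → ℝ)
    {Y : ι → Set X} (hY : ∀ i, RelDefinable L A (Y i)) {r : ℝ}
    (h : ∀ x, ∑ i ∈ s, (Y i).indicator (fun _ => c i) x ≤ r) : ∑ i ∈ s, c i * ν.eval (Y i) ≤ r := by
  simpa [ν.eval_univ] using ν.sum_mul_eval_inter_le s c hY (RelDefinable.univ A) fun x _ => h x

end KeislerMeasure

theorem KeislerMeasure.IsLeftInvariant.eval_preimage_mul_left {G : Set (Fin n → M)} [Group G]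
    {ν : GlobalKeislerMeasure L G} (hν : ν.IsLeftInvariant) {g : G} {Y : Set G}
    (hY : RelDefinable L Set.univ Y) (hgY : RelDefinable L Set.univ ((fun x => g * x) ⁻¹' Y)) :
    ν.eval ((fun x => g * x) ⁻¹' Y) = ν.eval Y := by
  rw [ν.eval_eq hY, ν.eval_eq hgY]
  exact (hν g ⟨_, hgY⟩ ⟨Y, hY⟩
    (Set.image_preimage_eq Y (MulAction.surjective g)).symm).symm

end Keisler

section Haar

theorem exists_simpleFunc_forall_rel {α β : Type*} [TopologicalSpace α] [CompactSpace α]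
    [MeasurableSpace α] [OpensMeasurableSpace α] [Nonempty β] {r : α → β → Prop}
    (hr : ∀ b, IsOpen {a | r a b}) (h : ∀ a, ∃ b, r a b) :
    ∃ φ : SimpleFunc α β, ∀ a, r a (φ a) := by
  classical
  let P (s : Set α) : Prop := ∃ φ : SimpleFunc α β, ∀ a ∈ s, r a (φ a)
  suffices P Set.univ by simpa [P] using this
  refine isCompact_univ.induction_on (p := P) ?_ ?_ ?_ ?_
  · exact ⟨SimpleFunc.const α (Classical.arbitrary β), by simp⟩
  · rintro s t hst ⟨φ, hφ⟩
    exact ⟨φ, fun a ha => hφ a (hst ha)⟩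
  · rintro s t ⟨φ, hφ⟩ ⟨ψ, hψ⟩
    have hmeas : MeasurableSet {a | r a (φ a)} :=
      φ.measurableSet_cut _ fun b => (hr b).measurableSet
    refine ⟨SimpleFunc.piecewise _ hmeas φ ψ, fun a ha => ?_⟩
    by_cases hφa : r a (φ a)
    · simp [SimpleFunc.piecewise_apply, hφa]
    · simpa [SimpleFunc.piecewise_apply, hφa] using hψ a (ha.resolve_left fun ha => hφa (hφ a ha))
  · intro a _
    obtain ⟨b, hb⟩ := h a
    exact ⟨_, mem_nhdsWithin_of_mem_nhds ((hr b).mem_nhds hb), SimpleFunc.const α b,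
      fun a' ha' => ha'⟩

theorem exists_simpleFunc_measureReal_setOf_mul_mem_le {H : Type*} [Group H] [TopologicalSpace H]
    [IsTopologicalGroup H] [CompactSpace H] [MeasurableSpace H] [BorelSpace H] (m : Measure H)
    [IsFiniteMeasure m] [m.IsMulRightInvariant] {K U : Set H} (hK : IsCompact K) (hU : IsOpen U)
    (hKU : K ⊆ U) : ∃ φ : SimpleFunc H H, ∀ h, m.real {b | φ b * h ∈ K} ≤ m.real U := by
  obtain ⟨V, hV, hVK⟩ := compact_open_separated_mul_left hK hU hKU
  have hone : (1 : H) ∈ interior V := mem_interior_iff_mem_nhds.2 hV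
  obtain ⟨φ, hφ⟩ := exists_simpleFunc_forall_rel (r := fun b g : H => b / g ∈ interior V)
    (fun g => isOpen_interior.preimage (continuous_id.div' continuous_const))
    fun b => ⟨b, (div_self' b).symm ▸ hone⟩
  refine ⟨φ, fun h => ?_⟩
  have hsub : {b | φ b * h ∈ K} ⊆ (fun b => b * h) ⁻¹' U := fun b hb => by
    have hbU : b / φ b * (φ b * h) ∈ U := hVK (Set.mul_mem_mul (interior_subset (hφ b)) hb)
    rwa [← mul_assoc, div_mul_cancel] at hbU
  calc m.real {b | φ b * h ∈ K} ≤ m.real ((fun b => b * h) ⁻¹' U) := measureReal_mono hsub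
    _ = m.real U := congrArg ENNReal.toReal (measure_preimage_mul_right m h U)

theorem isMulRightInvariant_of_isHaarMeasure {H : Type*} [Group H] [TopologicalSpace H]
    [IsTopologicalGroup H] [LocallyCompactSpace H] [MeasurableSpace H] [BorelSpace H]
    (m : Measure H) [m.IsHaarMeasure] [IsProbabilityMeasure m] : m.IsMulRightInvariant := by
  refine ⟨fun g => ?_⟩
  have : IsProbabilityMeasure (m.map (· * g)) :=
    Measure.isProbabilityMeasure_map (measurable_mul_const g).aemeasurable
  exact Measure.isHaarMeasure_eq_of_isProbabilityMeasure _ _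

theorem le_measureReal_of_forall_isOpen {α : Type*} [TopologicalSpace α] [MeasurableSpace α]
    {m : Measure α} [IsFiniteMeasure m] [m.OuterRegular] {K : Set α} {r : ℝ}
    (h : ∀ U, IsOpen U → K ⊆ U → r ≤ m.real U) : r ≤ m.real K := by
  have hfin (s : Set α) : m s ≠ ⊤ := measure_ne_top m s
  rw [Measure.real, ← ENNReal.ofReal_le_iff_le_toReal (hfin K), K.measure_eq_iInf_isOpen]
  refine le_iInf₂ fun U hKU => le_iInf fun hU => ?_
  exact (ENNReal.ofReal_le_iff_le_toReal (hfin U)).2 (h U hU hKU)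

end Haar

section Domination

variable {L : FirstOrder.Language.{u, v}} {M : Type w} [L.Structure M] {n : ℕ}
  {X : Set (Fin n → M)} {C : Type z} [TopologicalSpace C] {f : X → C}

theorem IsDefinableMap.isClosed_image [Infinite M] [T3Space C] (hM : IsSaturated L M)
    (hf : IsDefinableMap L f) {Y : Set X} (hY : RelDefinable L Set.univ Y) :
    IsClosed (f '' Y) := by
  obtain ⟨A, hA, hclosed⟩ := hf
  obtain ⟨B, hB, D, hD, rfl⟩ := hY.exists_finite
  refine isClosed_of_closure_subset fun c hc => ?_
  let 𝓗 : Filter (Fin n → M) := map Subtype.val (comap f (𝓝 c) ⊓ 𝓟 (Subtype.val ⁻¹' D))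
  have : 𝓗.NeBot := by
    rw [mem_closure_iff_clusterPt, ClusterPt, ← map_principal, ← Filter.push_pull',
      map_neBot_iff] at hc
    exact hc.map _
  obtain ⟨t, ht⟩ := hM.exists_forall_typeDefinable_mem (hA.union (.of_finite hB)) 𝓗
  have htD : t ∈ D := ht D (mem_map.2 (mem_inf_of_right (mem_principal_self _)))
    (.of_definable (hD.mono Set.subset_union_right))
  have ht_image {E : Set C} (hE : E ∈ 𝓝 c) (hEc : IsClosed E) : t ∈ Subtype.val '' (f ⁻¹' E) :=
    ht _ (image_mem_map (mem_inf_of_left (preimage_mem_comap hE)))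
      ((hclosed E hEc).mono Set.subset_union_left)
  obtain ⟨x, -, rfl⟩ := ht_image univ_mem isClosed_univ
  have hfx : f x ∈ (𝓝 c).ker := by
    refine (closed_nhds_basis c).ker ▸ Set.mem_iInter₂.2 fun E hE => ?_
    exact Subtype.val_injective.mem_set_image.1 (ht_image hE.1 hE.2)
  rw [ker_nhds] at hfx
  exact ⟨x, htD, hfx⟩

theorem IsSaturated.exists_relDefinable_between [Infinite M] (hM : IsSaturated L M) {A : Set M}
    (hA : IsSmall A) (hf : ∀ D, IsClosed D → TypeDefinableOver L A (Subtype.val '' (f ⁻¹' D)))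
    {K U : Set C} (hK : IsClosed K) (hU : IsOpen U) (hKU : K ⊆ U) :
    ∃ Z : Set X, RelDefinable L A Z ∧ f ⁻¹' K ⊆ Z ∧ Z ⊆ f ⁻¹' U := by
  have hdisj : Disjoint (Subtype.val '' (f ⁻¹' K)) (Subtype.val '' (f ⁻¹' Uᶜ)) :=
    (Set.disjoint_image_iff Subtype.val_injective).2
      ((Set.disjoint_compl_right_iff_subset.2 hKU).preimage f)
  obtain ⟨D, hD, hKD, hDU⟩ :=
    hM.exists_definable_separation hA hA (hf K hK) (hf Uᶜ hU.isClosed_compl) hdisj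
  refine ⟨Subtype.val ⁻¹' D, ⟨D, hD, rfl⟩, Set.image_subset_iff.1 hKD, fun x hxD => ?_⟩
  by_contra hxU
  exact Set.disjoint_left.1 hDU hxD ⟨x, hxU, rfl⟩

variable [CompactSpace C] [T2Space C] [MeasurableSpace C] [BorelSpace C] {m : Measure C}
  [IsProbabilityMeasure m]

namespace IsCompactlyDominated

theorem measureReal_image_inter (hf : IsCompactlyDominated L X m f) {Y : Set X}
    (hY : RelDefinable L Set.univ Y) (Z : Set X) :
    m.real (f '' (Y ∩ Z)) = m.real (f '' Y ∩ f '' Z) := by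
  refine le_antisymm (measureReal_mono (Set.image_inter_subset f Y Z)) ?_
  let N : Set C := {c | (f ⁻¹' {c} ∩ Y).Nonempty ∧ (f ⁻¹' {c} ∩ Yᶜ).Nonempty}
  have hN : m.real N = 0 := (measureReal_eq_zero_iff).2 (hf.null Y hY)
  have hsub : f '' Y ∩ f '' Z ⊆ f '' (Y ∩ Z) ∪ N := by
    rintro c ⟨⟨y, hy, hyc⟩, z, hz, hzc⟩
    by_cases hzY : z ∈ Y
    exacts [Or.inl ⟨z, ⟨hzY, hz⟩, hzc⟩, Or.inr ⟨⟨y, hyc, hy⟩, z, hzc, hzY⟩]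
  calc m.real (f '' Y ∩ f '' Z) ≤ m.real (f '' (Y ∩ Z)) + m.real N :=
        (measureReal_mono hsub).trans (measureReal_union_le _ _)
    _ = m.real (f '' (Y ∩ Z)) := by rw [hN, add_zero]

variable [Infinite M]

/-- The Keisler measure `Y ↦ m (f Y)` of a compactly dominated set. -/
noncomputable def measure (hM : IsSaturated L M) (hf : IsCompactlyDominated L X m f) :
    GlobalKeislerMeasure L X where
  toFun Y := m.real (f '' Y.1)
  mem_Icc _ := ⟨measureReal_nonneg, measureReal_le_one⟩
  empty := by rw [Set.image_empty, measureReal_empty]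
  univ := by rw [Set.image_univ_of_surjective hf.surjective, probReal_univ]
  union Y Z := by
    have hZ : MeasurableSet (f '' Z.1) := (hf.definable.isClosed_image hM Z.2).measurableSet
    rw [Set.image_union, hf.measureReal_image_inter Y.2, eq_sub_iff_add_eq,
      measureReal_union_add_inter hZ]

theorem eval_measure (hM : IsSaturated L M) (hf : IsCompactlyDominated L X m f) {Y : Set X}
    (hY : RelDefinable L Set.univ Y) : (hf.measure hM).eval Y = m.real (f '' Y) :=
  KeislerMeasure.eval_eq _ hY

theorem eq_measure_of_eval_le [m.OuterRegular] (hM : IsSaturated L M)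
    (hf : IsCompactlyDominated L X m f) {ν : GlobalKeislerMeasure L X}
    (h : ∀ Y, RelDefinable L Set.univ Y → ∀ U, IsOpen U → f '' Y ⊆ U → ν.eval Y ≤ m.real U) :
    ν = hf.measure hM := by
  refine KeislerMeasure.eq_of_eval_le fun Y hY => ?_
  rw [hf.eval_measure hM hY]
  exact le_measureReal_of_forall_isOpen (h Y hY)

theorem isSmoothOver_measure [m.OuterRegular] (hM : IsSaturated L M)
    (hf : IsCompactlyDominated L X m f) {A : Set M} (hA : IsSmall A)
    (hclosed : ∀ D, IsClosed D → TypeDefinableOver L A (Subtype.val '' (f ⁻¹' D))) :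
    (hf.measure hM).IsSmoothOver A := by
  refine fun ν hν => hf.eq_measure_of_eval_le hM fun Y hY U hU hYU => ?_
  obtain ⟨Z, hZA, hYZ, hZU⟩ := hM.exists_relDefinable_between hA hclosed
    (hf.definable.isClosed_image hM hY) hU hYU
  have hZ : RelDefinable L Set.univ Z := hZA.mono (Set.subset_univ A)
  have heval : ν.eval Z = (hf.measure hM).eval Z := by
    rw [ν.eval_eq hZ, KeislerMeasure.eval_eq _ hZ]
    exact congrFun (congrArg KeislerMeasure.toFun hν) ⟨Z, hZA⟩
  calc ν.eval Y ≤ ν.eval Z := ν.eval_mono hY hZ ((Set.subset_preimage_image f Y).trans hYZ)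
    _ = m.real (f '' Z) := by rw [heval, hf.eval_measure hM hZ]
    _ ≤ m.real U := measureReal_mono (Set.image_subset_iff.2 hZU)

end IsCompactlyDominated

end Domination

section Group

variable {L : FirstOrder.Language.{u, v}} {M : Type w} [L.Structure M] [Infinite M] {n : ℕ}
  {G : Set (Fin n → M)} [Group G] {H : Type z} [Group H] [TopologicalSpace H]
  [IsTopologicalGroup H] [CompactSpace H] [T2Space H] [MeasurableSpace H] [BorelSpace H]
  {m : Measure H} [IsProbabilityMeasure m] {π : G →* H}

namespace IsCompactlyDominated

theorem isLeftInvariant_measure [m.IsMulLeftInvariant] (hM : IsSaturated L M)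
    (hπ : IsCompactlyDominated L G m π) : (hπ.measure hM).IsLeftInvariant := by
  rintro g Y ⟨_, hgY⟩ rfl
  have himage : π '' ((fun x => g * x) '' Y.1) = (fun h => (π g)⁻¹ * h) ⁻¹' (π '' Y.1) := by
    have hsemi : Function.Semiconj π (g * ·) (π g * ·) := map_mul π g
    rw [← Set.image_mul_left, hsemi.set_image]
  change m.real (π '' _) = m.real (π '' Y.1)
  rw [himage, Measure.real, measure_preimage_mul, Measure.real]

theorem isRightInvariant_measure [m.IsMulRightInvariant] (hM : IsSaturated L M)
    (hπ : IsCompactlyDominated L G m π) : (hπ.measure hM).IsRightInvariant := by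
  rintro g Y ⟨_, hYg⟩ rfl
  have himage : π '' ((fun x => x * g) '' Y.1) = (fun h => h * (π g)⁻¹) ⁻¹' (π '' Y.1) := by
    have hsemi : Function.Semiconj π (· * g) (· * π g) := fun x => map_mul π x g
    rw [← Set.image_mul_right, hsemi.set_image]
  change m.real (π '' _) = m.real (π '' Y.1)
  rw [himage, Measure.real, measure_preimage_mul_right, Measure.real]

theorem eval_le_of_isLeftInvariant [m.IsMulRightInvariant] (hM : IsSaturated L M)
    (hG : IsTypeDefinableGroup L G) (hπ : IsCompactlyDominated L G m π)
    {ν : GlobalKeislerMeasure L G} (hν : ν.IsLeftInvariant) {Y : Set G}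
    (hY : RelDefinable L Set.univ Y) {U : Set H} (hU : IsOpen U) (hYU : π '' Y ⊆ U) :
    ν.eval Y ≤ m.real U := by
  obtain ⟨φ, hφ⟩ := exists_simpleFunc_measureReal_setOf_mul_mem_le m
    (hπ.definable.isClosed_image hM hY).isCompact hU hYU
  let σ : H → G := Function.surjInv hπ.surjective
  have hσ (h : H) : π (σ h) = h := Function.surjInv_eq hπ.surjective h
  let c (h : H) : ℝ := m.real (φ ⁻¹' {h})
  have sum_c (s : Finset H) : ∑ h ∈ s, c h = m.real (φ ⁻¹' s) :=
    sum_measureReal_preimage_singleton s fun h _ => φ.measurableSet_fiber h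
  have sum_c_range : ∑ h ∈ φ.range, c h = 1 := by
    rw [sum_c, φ.coe_range, Set.preimage_range, probReal_univ]
  have hgY (h : H) : RelDefinable L Set.univ ((fun x => σ h * x) ⁻¹' Y) :=
    hG.relDefinable_preimage_mul_left hM (σ h) hY
  have hindicator (x : G) :
      ∑ h ∈ φ.range, ((fun x => σ h * x) ⁻¹' Y).indicator (fun _ => c h) x ≤ m.real U := by
    classical
    rw [Finset.sum_indicator_eq_sum_filter, sum_c]
    refine (measureReal_mono fun b hb => ?_).trans (hφ (π x))
    exact ⟨σ (φ b) * x, (Finset.mem_filter.1 hb).2, by rw [map_mul, hσ]⟩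
  calc ν.eval Y = ∑ h ∈ φ.range, c h * ν.eval ((fun x => σ h * x) ⁻¹' Y) := by
        simp_rw [hν.eval_preimage_mul_left hY (hgY _), ← Finset.sum_mul, sum_c_range, one_mul]
    _ ≤ m.real U := ν.sum_mul_eval_le _ c hgY hindicator

theorem eq_measure_of_isLeftInvariant [m.IsMulRightInvariant] [m.OuterRegular]
    (hM : IsSaturated L M) (hG : IsTypeDefinableGroup L G) (hπ : IsCompactlyDominated L G m π)
    {ν : GlobalKeislerMeasure L G} (hν : ν.IsLeftInvariant) : ν = hπ.measure hM :=
  hπ.eq_measure_of_eval_le hM fun _ hY _ => hπ.eval_le_of_isLeftInvariant hM hG hν hY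

end IsCompactlyDominated

end Group

end CompactDomination

theorem theorem9p5 {L : FirstOrder.Language.{u, v}} {M : Type w} [L.Structure M]
    (hM : IsLargeSaturated L M)
    {n : ℕ} (G : Set (Fin n → M)) [Group G] (hG : IsTypeDefinableGroup L G)
    {H : Type z} [Group H] [TopologicalSpace H] [IsTopologicalGroup H] [CompactSpace H]
    [T2Space H] [MeasurableSpace H] [BorelSpace H]
    (π : G →* H) (hπ : IsCompactlyDominatedGroup L G π) :
    ∃ μ : GlobalKeislerMeasure L G,
      μ.IsLeftInvariant ∧
      (∀ ν : GlobalKeislerMeasure L G, ν.IsLeftInvariant → ν = μ) ∧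
      μ.IsRightInvariant ∧
      μ.IsSmooth := by
  have : Infinite M := Cardinal.infinite_iff.2 hM.aleph0_lt.le
  have : (normalizedHaar H).IsHaarMeasure := MeasureTheory.Measure.isHaarMeasure_haarMeasure _
  have : (normalizedHaar H).Regular := MeasureTheory.Measure.regular_haarMeasure
  have : (normalizedHaar H).IsMulRightInvariant := isMulRightInvariant_of_isHaarMeasure _
  obtain ⟨A, hA, hclosed⟩ := hπ.definable
  obtain ⟨M₀, hAM₀, hM₀⟩ :=
    exists_small_elementarySubstructure hM.aleph0_lt hM.card_language_lt hA
  have hclosed₀ (D : Set H) (hD : IsClosed D) := (hclosed D hD).mono hAM₀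
  have hGM₀ : TypeDefinableOver L (M₀ : Set M) G := by
    simpa only [Set.preimage_univ, Set.image_univ, Subtype.range_coe] using
      hclosed₀ Set.univ isClosed_univ
  exact ⟨hπ.measure hM.saturated, hπ.isLeftInvariant_measure hM.saturated,
    fun ν hν => hπ.eq_measure_of_isLeftInvariant hM.saturated hG hν,
    hπ.isRightInvariant_measure hM.saturated,
    M₀, hM₀, hGM₀, hπ.isSmoothOver_measure hM.saturated hM₀ hclosed₀⟩
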